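/- Let $k$ be a field. For power series $f_1,\dots,f_n$ without constant term in a power series ring $S$ over $k$, write $k[[f_1,\dots,f_n]]$ for the subring of $S$ of all $F(f_1,\dots,f_n)$ with $F$ a formal power series in $n$ variables over $k$. Let $A^*$ denote the unit group of a ring $A$, and $G_{\mathrm{ab}}$ the abelianization of a group $G$; isomorphisms are isomorphisms of groups. (a) If $\operatorname{char} k\neq 2$, $R=k[[s^2,st,t^2]]\subseteq k[[s,t]]$ and $I$ is the ideal $(s^2,st)R$, then $\operatorname{Aut}_R(R\oplus I)_{\mathrm{ab}}\cong k^*\oplus R^*$. (b) If $\operatorname{char} k\notin\{2,3\}$, $R=k[[x^2,xy,xz,y^2,yz,z^2]]\subseteq k[[x,y,z]]$ and $I$ is the ideal $(x^2,xy,xz)R$, then $\operatorname{Aut}_R(R\oplus I)_{\mathrm{ab}}\cong k^*\oplus R^*$. -/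

import Mathlib

/-- `k[[f₁, …, fₙ]]` inside `k[[x_i : i ∈ σ]]`, for power series `f₁, …, fₙ` without constant term:
the subalgebra of all `F(f₁, …, fₙ)`, where `F` runs over the formal power series in `n` variables
over `k`, i.e. the image of the substitution homomorphism. -/
noncomputable def powerSeriesSubalgebra {k : Type*} [Field k] {σ τ : Type*} [Finite τ]
    (f : τ → MvPowerSeries σ k) (hf : ∀ i, MvPowerSeries.constantCoeff (f i) = 0) :
    Subalgebra k (MvPowerSeries σ k) :=
  (MvPowerSeries.substAlgHom (R := k)
    (MvPowerSeries.hasSubst_of_constantCoeff_zero hf)).range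

theorem mem_powerSeriesSubalgebra {k : Type*} [Field k] {σ τ : Type*} [Finite τ]
    (f : τ → MvPowerSeries σ k) (hf : ∀ i, MvPowerSeries.constantCoeff (f i) = 0) (i : τ) :
    f i ∈ powerSeriesSubalgebra f hf :=
  ⟨MvPowerSeries.X i, by
    simp [MvPowerSeries.subst_X (MvPowerSeries.hasSubst_of_constantCoeff_zero hf)]⟩

section TwoVariables

variable (k : Type*) [Field k]

/-- `s², st, t²` in `k[[s, t]]`. -/
noncomputable def gensTwo : Fin 3 → MvPowerSeries (Fin 2) k :=
  let s := MvPowerSeries.X 0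
  let t := MvPowerSeries.X 1
  ![s ^ 2, s * t, t ^ 2]

theorem constantCoeff_gensTwo (i : Fin 3) :
    MvPowerSeries.constantCoeff (gensTwo k i) = 0 := by
  fin_cases i <;> simp [gensTwo]

/-- The ring `k[[s², st, t²]]`. -/
noncomputable abbrev RingTwo : Subalgebra k (MvPowerSeries (Fin 2) k) :=
  powerSeriesSubalgebra (gensTwo k) (constantCoeff_gensTwo k)

/-- The ideal `(s², st)` of `k[[s², st, t²]]`. -/
noncomputable def idealTwo : Ideal (RingTwo k) :=
  Ideal.span
    {⟨MvPowerSeries.X 0 ^ 2, mem_powerSeriesSubalgebra _ (constantCoeff_gensTwo k) 0⟩,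
     ⟨MvPowerSeries.X 0 * MvPowerSeries.X 1,
       mem_powerSeriesSubalgebra _ (constantCoeff_gensTwo k) 1⟩}

end TwoVariables

section ThreeVariables

variable (k : Type*) [Field k]

/-- `x², xy, xz, y², yz, z²` in `k[[x, y, z]]`. -/
noncomputable def gensThree : Fin 6 → MvPowerSeries (Fin 3) k :=
  let x := MvPowerSeries.X 0
  let y := MvPowerSeries.X 1
  let z := MvPowerSeries.X 2
  ![x ^ 2, x * y, x * z, y ^ 2, y * z, z ^ 2]

theorem constantCoeff_gensThree (i : Fin 6) :
    MvPowerSeries.constantCoeff (gensThree k i) = 0 := by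
  fin_cases i <;> simp [gensThree]

/-- The ring `k[[x², xy, xz, y², yz, z²]]`. -/
noncomputable abbrev RingThree : Subalgebra k (MvPowerSeries (Fin 3) k) :=
  powerSeriesSubalgebra (gensThree k) (constantCoeff_gensThree k)

/-- The ideal `(x², xy, xz)` of `k[[x², xy, xz, y², yz, z²]]`. -/
noncomputable def idealThree : Ideal (RingThree k) :=
  Ideal.span
    {⟨MvPowerSeries.X 0 ^ 2, mem_powerSeriesSubalgebra _ (constantCoeff_gensThree k) 0⟩,
     ⟨MvPowerSeries.X 0 * MvPowerSeries.X 1,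
       mem_powerSeriesSubalgebra _ (constantCoeff_gensThree k) 1⟩,
     ⟨MvPowerSeries.X 0 * MvPowerSeries.X 2,
       mem_powerSeriesSubalgebra _ (constantCoeff_gensThree k) 2⟩}

end ThreeVariables

/-!
Let `S` be the ring of power series, `θ` the involution that changes the sign of every variable, and
call `f` even if `θ f = f` and odd if `θ f = -f`. As `2` is invertible, the given ring `R`, generated
by all quadratic monomials, is the ring of even power series (`mem_powerSeriesSubalgebra_iff`), and
the given ideal `I` is `x • M`, where `x` is the first variable and `M` is the `R`-module of odd
power series (`mem_span_X_mul_iff`). Hence `R ⊕ I ≅ R ⊕ M`.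

Since `x` and another variable `y` are odd without common factor, an `R`-linear map from `M` to `S`
is a multiplication (`exists_eq_mul_of_linearMap_oddPart`). So the endomorphism ring of `R ⊕ M`
consists of the matrices `(a b; c d)` over `S` with `a`, `d` even and `b`, `c` odd
(`gradedMatricesAction_bijective`).

On its unit group, the determinant is a homomorphism to `Rˣ`, and the residue of `a` is one
to `kˣ`, because `bc` lies in the maximal ideal. Together they are surjective onto the abelian group
`kˣ × Rˣ`, and their kernel is the commutator subgroup (`mem_commutatorMatrices`): transvections are
commutators with `diag(-1, 1)`, as `2` is invertible; by Whitehead's identity `diag(u, u⁻¹)` is a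
product of transvections for `u = 1 + bc`; and these `u` generate `1 + 𝔪`, because the maximal
ideal `𝔪` of `R` is generated by products of two odd elements.
-/

/-! ### The unit group of the ring of graded matrices -/

section GradedMatrices

variable {k S : Type*} [Field k] [CommRing S] [Algebra k S]

/-- For an endomorphism `θ` of `S`, thought of as an involution that gives `S` a parity: the ring of
2 × 2 matrices over `S` whose diagonal entries are even (`θ f = f`) and whose off-diagonal entries
are odd (`θ f = -f`). -/
def gradedMatrices (θ : S →ₐ[k] S) : Subring (Matrix (Fin 2) (Fin 2) S) where
  carrier := {A | (θ (A 0 0) = A 0 0 ∧ θ (A 1 1) = A 1 1) ∧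
    θ (A 0 1) = -A 0 1 ∧ θ (A 1 0) = -A 1 0}
  mul_mem' := by
    rintro A B ⟨⟨h1, h2⟩, h3, h4⟩ ⟨⟨g1, g2⟩, g3, g4⟩
    simp [Matrix.mul_apply, h1, h2, h3, h4, g1, g2, g3, g4, add_comm]
  one_mem' := by simp
  add_mem' := by
    rintro A B ⟨⟨h1, h2⟩, h3, h4⟩ ⟨⟨g1, g2⟩, g3, g4⟩
    simp [h1, h2, h3, h4, g1, g2, g3, g4, add_comm]
  zero_mem' := by simp
  neg_mem' := by
    rintro A ⟨⟨h1, h2⟩, h3, h4⟩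
    simp [h1, h2, h3, h4]

theorem mem_gradedMatrices {θ : S →ₐ[k] S} {a b c d : S} :
    !![a, b; c, d] ∈ gradedMatrices θ ↔ (θ a = a ∧ θ d = d) ∧ θ b = -b ∧ θ c = -c :=
  Iff.rfl

variable (θ : S →ₐ[k] S) (χ : S →ₐ[k] k)

/-- The matrices that represent an element of the commutator subgroup of the unit group of
`gradedMatrices θ`. -/
def commutatorMatrices : Submonoid (Matrix (Fin 2) (Fin 2) S) :=
  (commutator (gradedMatrices θ)ˣ).toSubmonoid.map
    ((gradedMatrices θ).subtype.toMonoidHom.comp (Units.coeHom (gradedMatrices θ)))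

variable {θ}

theorem coe_mem_commutatorMatrices {g : (gradedMatrices θ)ˣ} :
    ((g : gradedMatrices θ) : Matrix (Fin 2) (Fin 2) S) ∈ commutatorMatrices θ ↔
      g ∈ commutator (gradedMatrices θ)ˣ := by
  constructor
  · rintro ⟨h, hh, e⟩
    have : h = g := Units.ext (Subtype.ext e)
    exact this ▸ hh
  · exact fun h => ⟨g, h, rfl⟩

theorem mul_mul_mul_mem_commutatorMatrices {A A' B B' : Matrix (Fin 2) (Fin 2) S}
    (hA : A ∈ gradedMatrices θ) (hA' : A' ∈ gradedMatrices θ) (hB : B ∈ gradedMatrices θ)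
    (hB' : B' ∈ gradedMatrices θ) (h₁ : A * A' = 1) (h₂ : A' * A = 1) (h₃ : B * B' = 1)
    (h₄ : B' * B = 1) : A * B * A' * B' ∈ commutatorMatrices θ := by
  let g : (gradedMatrices θ)ˣ := ⟨⟨A, hA⟩, ⟨A', hA'⟩, Subtype.ext h₁, Subtype.ext h₂⟩
  let h : (gradedMatrices θ)ˣ := ⟨⟨B, hB⟩, ⟨B', hB'⟩, Subtype.ext h₃, Subtype.ext h₄⟩
  exact ⟨_, Subgroup.commutator_mem_commutator (Subgroup.mem_top g) (Subgroup.mem_top h), rfl⟩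

theorem upper_mem_commutatorMatrices (h2 : (2 : k) ≠ 0) {b : S} (hb : θ b = -b) :
    !![1, b; 0, 1] ∈ commutatorMatrices θ := by
  -- conjugation by `diag(-1, 1)` inverts the transvection with entry `b' = -b / 2`
  set b' : S := -((2 : k)⁻¹ • b) with hb'
  have hθ : θ b' = -b' := by simp [hb', hb]
  have h : b = -b' + -b' := by
    rw [hb', neg_neg, ← add_smul, ← two_mul, mul_inv_cancel₀ h2, one_smul]
  have := mul_mul_mul_mem_commutatorMatrices (θ := θ) (A := !![-1, 0; 0, 1])
    (A' := !![-1, 0; 0, 1]) (B := !![1, b'; 0, 1]) (B' := !![1, -b'; 0, 1])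
    (by simp [mem_gradedMatrices]) (by simp [mem_gradedMatrices])
    (by simp [mem_gradedMatrices, hθ]) (by simp [mem_gradedMatrices, hθ])
    (by simp [Matrix.one_fin_two]) (by simp [Matrix.one_fin_two])
    (by simp [Matrix.one_fin_two]) (by simp [Matrix.one_fin_two])
  simpa [h] using this

theorem lower_mem_commutatorMatrices (h2 : (2 : k) ≠ 0) {c : S} (hc : θ c = -c) :
    !![1, 0; c, 1] ∈ commutatorMatrices θ := by
  set c' : S := -((2 : k)⁻¹ • c) with hc'
  have hθ : θ c' = -c' := by simp [hc', hc]
  have h : c = -c' + -c' := by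
    rw [hc', neg_neg, ← add_smul, ← two_mul, mul_inv_cancel₀ h2, one_smul]
  have := mul_mul_mul_mem_commutatorMatrices (θ := θ) (A := !![1, 0; 0, -1])
    (A' := !![1, 0; 0, -1]) (B := !![1, 0; c', 1]) (B' := !![1, 0; -c', 1])
    (by simp [mem_gradedMatrices]) (by simp [mem_gradedMatrices])
    (by simp [mem_gradedMatrices, hθ]) (by simp [mem_gradedMatrices, hθ])
    (by simp [Matrix.one_fin_two]) (by simp [Matrix.one_fin_two])
    (by simp [Matrix.one_fin_two]) (by simp [Matrix.one_fin_two])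
  simpa [h] using this

theorem map_inv_of_mul_eq_one {u v : S} (hu : θ u = u) (huv : u * v = 1) : θ v = v := by
  have h : u * θ v = 1 := by simpa [hu] using congrArg θ huv
  linear_combination v * h - θ v * huv

/-- Whitehead's identity: for odd `b`, `c` the matrix `diag(1 + bc, (1 + bc)⁻¹)` is a product of
transvections. -/
theorem diag_one_add_mul_mem_commutatorMatrices (h2 : (2 : k) ≠ 0) {b c v : S} (hb : θ b = -b)
    (hc : θ c = -c) (hv : (1 + b * c) * v = 1) :
    !![1 + b * c, 0; 0, v] ∈ commutatorMatrices θ := by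
  have hθ : θ v = v := map_inv_of_mul_eq_one (by simp [hb, hc]) hv
  have h := mul_mem (mul_mem (mul_mem
    (lower_mem_commutatorMatrices h2 (c := -(c * v)) (by simp [hc, hθ]))
    (upper_mem_commutatorMatrices h2 hb)) (lower_mem_commutatorMatrices h2 hc))
    (upper_mem_commutatorMatrices h2 (b := -(b * v)) (by simp [hb, hθ]))
  convert h using 1
  ext i j
  fin_cases i <;> fin_cases j <;> simp [Matrix.mul_apply]
  · linear_combination b * hv
  · linear_combination c * hv
  · linear_combination (1 - b * c * v) * hv

/-- `diag(a, a⁻¹)` is a product of commutators when `a - 1` is a finite sum of products of odd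
elements: such an `a` is a product of factors of the form `1 + bc` with `b`, `c` odd. -/
theorem diag_one_add_sum_mem_commutatorMatrices (h2 : (2 : k) ≠ 0)
    (hunit : ∀ f : S, χ f ≠ 0 → IsUnit f) (hodd : ∀ f, θ f = -f → χ f = 0)
    {ι : Type*} (s : Finset ι) (f g : ι → S) (hf : ∀ i, θ (f i) = -f i)
    (hg : ∀ i, θ (g i) = -g i) (v : S) (hv : (1 + ∑ i ∈ s, f i * g i) * v = 1) :
    !![1 + ∑ i ∈ s, f i * g i, 0; 0, v] ∈ commutatorMatrices θ := by
  classical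
  induction s using Finset.induction_on generalizing v with
  | empty =>
    have : v = 1 := by simpa using hv
    simp [this, ← Matrix.one_fin_two]
  | insert i s hi ih =>
    rw [Finset.sum_insert hi] at hv ⊢
    set u : S := 1 + ∑ i ∈ s, f i * g i with hu
    have hχ : χ u = 1 := by simp [hu, hodd _ (hf _)]
    obtain ⟨w, hw⟩ := (hunit u (by simp [hχ])).exists_right_inv
    have hθu : θ u = u := by simp [hu, hf, hg]
    have hθw : θ w = w := map_inv_of_mul_eq_one hθu hw
    -- `u + f i * g i = (1 + f i * (g i / u)) * u`
    have key := mul_mem (diag_one_add_mul_mem_commutatorMatrices h2 (b := f i) (c := g i * w)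
      (v := u * v) (hf i) (by simp [hg, hθw])
      (by linear_combination hv + f i * g i * v * hw)) (ih w hw)
    convert key using 1
    ext a b
    fin_cases a <;> fin_cases b <;> simp [Matrix.mul_apply]
    · linear_combination - f i * g i * hw
    · linear_combination - v * hw

/-- A graded matrix of determinant `1` whose upper left entry has residue `1` is a product of
commutators: elimination reduces it to `diag(a, a⁻¹)` with `a - 1` in the maximal ideal of the even
subring, and that ideal is generated by products of odd elements (`hgen`). -/
theorem mem_commutatorMatrices (h2 : (2 : k) ≠ 0)
    (hunit : ∀ f : S, χ f ≠ 0 → IsUnit f) (hodd : ∀ f, θ f = -f → χ f = 0)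
    (hgen : ∀ a : S, θ a = a → χ a = 0 → ∃ (n : ℕ) (f g : Fin n → S),
      (∀ i, θ (f i) = -f i) ∧ (∀ i, θ (g i) = -g i) ∧ a = ∑ i, f i * g i)
    {A : Matrix (Fin 2) (Fin 2) S} (hA : A ∈ gradedMatrices θ) (hdet : A.det = 1)
    (hχ : χ (A 0 0) = 1) : A ∈ commutatorMatrices θ := by
  obtain ⟨⟨ha, hd⟩, hb, hc⟩ := hA
  obtain ⟨w, hw⟩ := (hunit (A 0 0) (by simp [hχ])).exists_right_inv
  have hθw : θ w = w := map_inv_of_mul_eq_one ha hw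
  obtain ⟨n, f, g, hf, hg, e⟩ := hgen (A 0 0 - 1) (by simp [ha]) (by simp [hχ])
  have e' : A 0 0 = 1 + ∑ i, f i * g i := by rw [← e]; ring
  have h := diag_one_add_sum_mem_commutatorMatrices χ h2 hunit hodd Finset.univ f g hf hg w
    (by rw [← e', hw])
  rw [← e'] at h
  have key := mul_mem (mul_mem (lower_mem_commutatorMatrices h2 (c := A 1 0 * w)
    (by simp [hc, hθw])) h) (upper_mem_commutatorMatrices h2 (b := A 0 1 * w) (by simp [hb, hθw]))
  rw [Matrix.det_fin_two] at hdet
  convert key using 1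
  ext i j
  fin_cases i <;> fin_cases j <;> simp [Matrix.mul_apply]
  · linear_combination - A 0 1 * hw
  · linear_combination - A 1 0 * hw
  · linear_combination w * hdet - A 1 1 * hw - A 1 0 * w * A 0 1 * hw

variable (R : Subalgebra k S)

/-- The determinant of a graded matrix, as an element of the even subring `R`. -/
def gradedDet (hR : ∀ f, f ∈ R ↔ θ f = f) : gradedMatrices θ →* R where
  toFun A := ⟨(A : Matrix (Fin 2) (Fin 2) S).det, by
    obtain ⟨A, ⟨ha, hd⟩, hb, hc⟩ := A
    rw [hR]
    simp [Matrix.det_fin_two, ha, hb, hc, hd]⟩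
  map_one' := Subtype.ext (by simp)
  map_mul' A B := Subtype.ext (by simp)

/-- The residue class of the upper left entry of a graded matrix. It is multiplicative because
odd elements vanish in the residue field. -/
def gradedResidue (hodd : ∀ f, θ f = -f → χ f = 0) : gradedMatrices θ →* k where
  toFun A := χ ((A : Matrix (Fin 2) (Fin 2) S) 0 0)
  map_one' := by simp
  map_mul' A B := by
    simp [Matrix.mul_apply, hodd _ A.2.2.1]

theorem nonempty_abelianization_units_gradedMatrices (h2 : (2 : k) ≠ 0)
    (hunit : ∀ f : S, χ f ≠ 0 → IsUnit f) (hodd : ∀ f, θ f = -f → χ f = 0)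
    (hgen : ∀ a : S, θ a = a → χ a = 0 → ∃ (n : ℕ) (f g : Fin n → S),
      (∀ i, θ (f i) = -f i) ∧ (∀ i, θ (g i) = -g i) ∧ a = ∑ i, f i * g i)
    (hR : ∀ f, f ∈ R ↔ θ f = f) :
    Nonempty (Abelianization (gradedMatrices θ)ˣ ≃* kˣ × Rˣ) := by
  let φ : (gradedMatrices θ)ˣ →* kˣ × Rˣ :=
    (Units.map (gradedResidue χ hodd)).prod (Units.map (gradedDet R hR))
  have hsurj : Function.Surjective φ := by
    rintro ⟨c, r⟩
    have hr : θ ((r : R) : S) = (r : R) := (hR _).1 (r : R).2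
    have hr' : θ (((r⁻¹ : Rˣ) : R) : S) = ((r⁻¹ : Rˣ) : R) := (hR _).1 ((r⁻¹ : Rˣ) : R).2
    have e₁ : ((r : R) : S) * ((r⁻¹ : Rˣ) : R) = 1 := congrArg Subtype.val r.mul_inv
    have e₂ : algebraMap k S c * algebraMap k S (c⁻¹ : kˣ) = 1 := by
      rw [← map_mul, c.mul_inv, map_one]
    refine ⟨⟨⟨!![algebraMap k S c, 0; 0, algebraMap k S (c⁻¹ : kˣ) * (r : R)], ?_⟩,
      ⟨!![algebraMap k S (c⁻¹ : kˣ), 0; 0, algebraMap k S c * ((r⁻¹ : Rˣ) : R)], ?_⟩, ?_, ?_⟩, ?_⟩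
    · rw [mem_gradedMatrices]; simp [-Units.val_inv_eq_inv_val, hr]
    · rw [mem_gradedMatrices]; simp [-Units.val_inv_eq_inv_val, hr']
    · ext i j
      fin_cases i <;> fin_cases j <;> simp [-Units.val_inv_eq_inv_val, Algebra.smul_def]
      · exact e₂
      · linear_combination ((r : R) : S) * ((r⁻¹ : Rˣ) : R) * e₂ + e₁
    · ext i j
      fin_cases i <;> fin_cases j <;> simp [-Units.val_inv_eq_inv_val, Algebra.smul_def]
      · linear_combination e₂
      · linear_combination ((r : R) : S) * ((r⁻¹ : Rˣ) : R) * e₂ + e₁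
    · refine Prod.ext (Units.ext ?_) (Units.ext (Subtype.ext ?_))
      · simp [φ, gradedResidue]
      · simp only [φ, gradedDet, MonoidHom.prod_apply, Units.coe_map, MonoidHom.coe_mk,
          OneHom.coe_mk, Matrix.det_fin_two_of]
        linear_combination ((r : R) : S) * e₂
  have hker : commutator (gradedMatrices θ)ˣ = φ.ker := by
    refine le_antisymm (Abelianization.commutator_subset_ker φ) fun g hg => ?_
    rw [MonoidHom.mem_ker, Prod.ext_iff] at hg
    rw [← coe_mem_commutatorMatrices]
    exact mem_commutatorMatrices χ h2 hunit hodd hgen (g : gradedMatrices θ).2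
      (congrArg (fun u : Rˣ => ((u : R) : S)) hg.2) (congrArg Units.val hg.1)
  exact ⟨(QuotientGroup.quotientMulEquivOfEq hker).trans
    (QuotientGroup.quotientKerEquivOfSurjective φ hsurj)⟩

end GradedMatrices

/-! ### Endomorphisms of the sum of the even and the odd part -/

section EndomorphismRing

variable {k S : Type*} [Field k] [CommRing S] [Algebra k S] {θ : S →ₐ[k] S}
  {R : Subalgebra k S}

/-- The odd part of `S`, as a module over the even subring `R`. -/
def oddPart (hR : ∀ f, f ∈ R ↔ θ f = f) : Submodule R S where
  carrier := {f | θ f = -f}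
  add_mem' {a b} ha hb := by
    rw [Set.mem_ofPred_eq] at *
    rw [map_add, ha, hb, neg_add]
  zero_mem' := by simp
  smul_mem' r f hf := by
    rw [Set.mem_ofPred_eq] at *
    rw [Subalgebra.smul_def, smul_eq_mul, map_mul, hf, (hR _).1 r.2, mul_neg]

theorem mem_oddPart {hR : ∀ f, f ∈ R ↔ θ f = f} {f : S} : f ∈ oddPart hR ↔ θ f = -f :=
  Iff.rfl

/-- A graded matrix acts on column vectors with an even upper and an odd lower entry. -/
def gradedMatricesAction (hR : ∀ f, f ∈ R ↔ θ f = f) :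
    gradedMatrices θ →* Module.End R (R × oddPart hR) where
  toFun A :=
    { toFun v := (⟨A.1 0 0 * v.1 + A.1 0 1 * v.2, by
          obtain ⟨⟨ha, hd⟩, hb, hc⟩ := A.2
          rw [hR]
          simp [ha, hb, (hR _).1 v.1.2, mem_oddPart.1 v.2.2]⟩,
        ⟨A.1 1 0 * v.1 + A.1 1 1 * v.2, by
          obtain ⟨⟨ha, hd⟩, hb, hc⟩ := A.2
          rw [mem_oddPart]
          simp [hc, hd, (hR _).1 v.1.2, mem_oddPart.1 v.2.2, add_comm]⟩)
      map_add' v w := by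
        refine Prod.ext (Subtype.ext ?_) (Subtype.ext ?_) <;> simp <;> ring
      map_smul' r v := by
        refine Prod.ext (Subtype.ext ?_) (Subtype.ext ?_) <;> simp [Subalgebra.smul_def] <;> ring }
  map_one' := by
    refine LinearMap.ext fun v => Prod.ext (Subtype.ext ?_) (Subtype.ext ?_) <;> simp
  map_mul' A B := by
    refine LinearMap.ext fun v => Prod.ext (Subtype.ext ?_) (Subtype.ext ?_) <;>
      simp [Matrix.mul_apply] <;> ring

theorem coe_gradedMatricesAction_fst {hR : ∀ f, f ∈ R ↔ θ f = f} (A : gradedMatrices θ)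
    (v : R × oddPart hR) :
    ((gradedMatricesAction hR A v).1 : S) = A.1 0 0 * v.1 + A.1 0 1 * v.2 :=
  rfl

theorem coe_gradedMatricesAction_snd {hR : ∀ f, f ∈ R ↔ θ f = f} (A : gradedMatrices θ)
    (v : R × oddPart hR) :
    ((gradedMatricesAction hR A v).2 : S) = A.1 1 0 * v.1 + A.1 1 1 * v.2 :=
  rfl

/-- An `R`-linear map from the odd part to `S` is the multiplication by an element of `S`, when
there are two odd elements `x`, `y` without a common factor. -/
theorem exists_eq_mul_of_linearMap_oddPart {hR : ∀ f, f ∈ R ↔ θ f = f} {x y : S}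
    (hx : θ x = -x) (hy : θ y = -y) (hx0 : IsLeftRegular x)
    (hxy : ∀ g, x ∣ y * g → x ∣ g) (φ : oddPart hR →ₗ[R] S) :
    ∃ b : S, ∀ m : oddPart hR, φ m = m * b := by
  have swap (m : S) (hm : θ m = -m) : m * φ ⟨x, hx⟩ = x * φ ⟨m, hm⟩ := by
    -- `(x * m) • x = (x * x) • m` in the odd part
    have h : (⟨x * m, (hR _).2 (by simp [hx, hm])⟩ : R) • (⟨x, hx⟩ : oddPart hR) =
        (⟨x * x, (hR _).2 (by simp [hx])⟩ : R) • (⟨m, hm⟩ : oddPart hR) :=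
      Subtype.ext (by simp [Subalgebra.smul_def]; ring)
    have h' := congrArg φ h
    simp only [map_smul, Subalgebra.smul_def, smul_eq_mul] at h'
    exact hx0 (by simpa only [mul_assoc] using h')
  obtain ⟨b, hb⟩ := hxy _ ⟨_, swap y hy⟩
  refine ⟨b, fun m => hx0 ?_⟩
  have := swap m m.2
  rw [hb] at this
  simp only
  linear_combination -this

theorem gradedMatricesAction_bijective (hR : ∀ f, f ∈ R ↔ θ f = f) {x y : S}
    (hx : θ x = -x) (hy : θ y = -y) (hx0 : IsLeftRegular x)
    (hxy : ∀ g, x ∣ y * g → x ∣ g) : Function.Bijective (gradedMatricesAction hR) := by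
  constructor
  · intro A B h
    have h₁ := congrArg (fun φ => φ ((1 : R), (0 : oddPart hR))) h
    have h₂ := congrArg (fun φ => φ ((0 : R), (⟨x, hx⟩ : oddPart hR))) h
    simp only [Prod.ext_iff, Subtype.ext_iff, coe_gradedMatricesAction_fst,
      coe_gradedMatricesAction_snd] at h₁ h₂
    simp only [OneMemClass.coe_one, ZeroMemClass.coe_zero, mul_one, mul_zero, add_zero,
      zero_add] at h₁ h₂
    refine Subtype.ext (Matrix.ext fun i j => ?_)
    fin_cases i <;> fin_cases j
    · exact h₁.1
    · exact hx0 ((mul_comm _ _).trans (h₂.1.trans (mul_comm _ _)))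
    · exact h₁.2
    · exact hx0 ((mul_comm _ _).trans (h₂.2.trans (mul_comm _ _)))
  · intro φ
    obtain ⟨b, hb⟩ := exists_eq_mul_of_linearMap_oddPart hx hy hx0 hxy
      (Algebra.linearMap R S ∘ₗ LinearMap.fst R R (oddPart hR) ∘ₗ φ ∘ₗ LinearMap.inr R R (oddPart hR))
    obtain ⟨d, hd⟩ := exists_eq_mul_of_linearMap_oddPart hx hy hx0 hxy
      ((oddPart hR).subtype ∘ₗ LinearMap.snd R R (oddPart hR) ∘ₗ φ ∘ₗ
        LinearMap.inr R R (oddPart hR))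
    replace hb : ∀ m, ((φ (0, m)).1 : S) = m * b := hb
    replace hd : ∀ m, ((φ (0, m)).2 : S) = m * d := hd
    -- the parity of `b` and `d` follows from that of `x * b` and `x * d`
    have hθb : θ b = -b := hx0 (by
      have := (hR _).1 (φ (0, ⟨x, hx⟩)).1.2
      rw [hb, map_mul, hx] at this
      linear_combination -this)
    have hθd : θ d = d := hx0 (by
      have := mem_oddPart.1 (φ (0, ⟨x, hx⟩)).2.2
      rw [hd, map_mul, hx] at this
      linear_combination -this)
    refine ⟨⟨!![((φ (1, 0)).1 : S), b; ((φ (1, 0)).2 : S), d],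
      mem_gradedMatrices.2 ⟨⟨(hR _).1 (φ (1, 0)).1.2, hθd⟩, hθb, (φ (1, 0)).2.2⟩⟩, ?_⟩
    refine LinearMap.ext fun ⟨r, m⟩ => ?_
    have h : φ (r, m) = r • φ (1, 0) + φ (0, m) := by
      rw [← map_smul, ← map_add]
      simp
    rw [h]
    refine Prod.ext (Subtype.ext ?_) (Subtype.ext ?_)
    · simp [coe_gradedMatricesAction_fst, hb, mul_comm]
    · simp [coe_gradedMatricesAction_snd, hd, mul_comm, Subalgebra.smul_def]

/-- Multiplication by the odd element `x` identifies the odd part with the ideal `I` of `R`. -/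
theorem nonempty_linearEquiv_oddPart (hR : ∀ f, f ∈ R ↔ θ f = f) {x : S} (hx : θ x = -x)
    (hx0 : IsLeftRegular x) (I : Ideal R)
    (hI : ∀ r : R, r ∈ I ↔ ∃ m, θ m = -m ∧ (r : S) = x * m) : Nonempty (oddPart hR ≃ₗ[R] I) := by
  let f : oddPart hR →ₗ[R] I :=
    { toFun m := ⟨⟨x * m, (hR _).2 (by simp [hx, mem_oddPart.1 m.2])⟩, (hI _).2 ⟨m, m.2, rfl⟩⟩
      map_add' m n := Subtype.ext (Subtype.ext (mul_add _ _ _))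
      map_smul' r m := Subtype.ext (Subtype.ext (mul_left_comm _ _ _)) }
  refine ⟨LinearEquiv.ofBijective f ⟨fun m n h => ?_, fun ⟨r, hr⟩ => ?_⟩⟩
  · exact Subtype.ext (hx0 (congrArg (fun u : I => ((u : R) : S)) h))
  · obtain ⟨m, hm, e⟩ := (hI r).1 hr
    exact ⟨⟨m, hm⟩, Subtype.ext (Subtype.ext e.symm)⟩

theorem nonempty_aut_mulEquiv_units_gradedMatrices (hR : ∀ f, f ∈ R ↔ θ f = f) {x y : S}
    (hx : θ x = -x) (hy : θ y = -y) (hx0 : IsLeftRegular x) (hxy : ∀ g, x ∣ y * g → x ∣ g)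
    (I : Ideal R) (hI : ∀ r : R, r ∈ I ↔ ∃ m, θ m = -m ∧ (r : S) = x * m) :
    Nonempty (((R × I) ≃ₗ[R] (R × I)) ≃* (gradedMatrices θ)ˣ) := by
  obtain ⟨e⟩ := nonempty_linearEquiv_oddPart hR hx hx0 I hI
  exact ⟨(LinearMap.GeneralLinearGroup.generalLinearEquiv R (R × I)).symm.trans <|
    Units.mapEquiv <| ((LinearEquiv.refl R R).prodCongr e).symm.conjRingEquiv.toMulEquiv.trans
      (MulEquiv.ofBijective _ (gradedMatricesAction_bijective hR hx hy hx0 hxy)).symm⟩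

end EndomorphismRing

/-! ### Even and odd power series -/

section ParityOfPowerSeries

open MvPowerSeries

variable {k : Type*} [Field k] {σ : Type*}

/-- The substitution `X i ↦ -X i`, whose fixed points are the power series all of whose terms have
even degree when `2 ≠ 0` in `k`. -/
noncomputable def parityInvolution (k σ : Type*) [Field k] :
    MvPowerSeries σ k →ₐ[k] MvPowerSeries σ k :=
  rescaleAlgHom fun _ => -1

theorem coeff_parityInvolution (f : MvPowerSeries σ k) (n : σ →₀ ℕ) :
    coeff n (parityInvolution k σ f) = (-1) ^ n.degree * coeff n f := by
  rw [parityInvolution, rescaleAlgHom_apply, coeff_rescale, Finsupp.prod,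
    Finset.prod_pow_eq_pow_sum, Finsupp.degree_apply]

theorem parityInvolution_X (i : σ) : parityInvolution k σ (X i) = -X i := by
  classical
  ext n
  rw [coeff_parityInvolution, map_neg, coeff_X]
  split_ifs with h <;> simp [h]

theorem parityInvolution_eq_self_iff (h2 : (2 : k) ≠ 0) {f : MvPowerSeries σ k} :
    parityInvolution k σ f = f ↔ ∀ n : σ →₀ ℕ, Odd n.degree → coeff n f = 0 := by
  rw [MvPowerSeries.ext_iff]
  refine forall_congr' fun n => ?_
  rw [coeff_parityInvolution]
  rcases Nat.even_or_odd n.degree with h | h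
  · simp [h.neg_one_pow, Nat.not_odd_iff_even.2 h]
  · simp only [h.neg_one_pow, h, forall_const]
    refine ⟨fun e => (mul_eq_zero.1 (?_ : 2 * coeff n f = 0)).resolve_left h2, fun e => by simp [e]⟩
    linear_combination -e

theorem parityInvolution_eq_neg_iff (h2 : (2 : k) ≠ 0) {f : MvPowerSeries σ k} :
    parityInvolution k σ f = -f ↔ ∀ n : σ →₀ ℕ, Even n.degree → coeff n f = 0 := by
  rw [MvPowerSeries.ext_iff]
  refine forall_congr' fun n => ?_
  rw [coeff_parityInvolution, map_neg]
  rcases Nat.even_or_odd n.degree with h | h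
  · simp only [h.neg_one_pow, h, forall_const]
    refine ⟨fun e => (mul_eq_zero.1 (?_ : 2 * coeff n f = 0)).resolve_left h2, fun e => by simp [e]⟩
    linear_combination e
  · simp [h.neg_one_pow, Nat.not_even_iff_odd.2 h]

/-- A power series `g` without constant term is a combination `∑ X i * f i` of the variables, where
each term of `f i` comes from a term of `g`, so that the parity of `g` is passed on to `f i`. -/
theorem exists_eq_sum_X_mul [Fintype σ] {g : MvPowerSeries σ k} (hg : constantCoeff g = 0) :
    ∃ f : σ → MvPowerSeries σ k, g = ∑ i, X i * f i ∧
      ∀ i m, coeff (m + Finsupp.single i 1) g = 0 → coeff m (f i) = 0 := by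
  classical
  rcases isEmpty_or_nonempty σ with _ | _
  · exact ⟨0, by ext m; simpa [Subsingleton.elim m 0] using hg, fun _ _ _ => by simp⟩
  have hc : ∀ m : σ →₀ ℕ, m ≠ 0 → ∃ i, m i ≠ 0 := fun m hm => by
    simpa [Finsupp.ext_iff] using hm
  choose! c hc using hc
  -- divide the term of exponent `m` by the variable `X (c m)`
  let f : σ → MvPowerSeries σ k := fun i m =>
    if c (m + Finsupp.single i 1) = i then coeff (m + Finsupp.single i 1) g else 0
  have hf (i m) : coeff m (f i) =
      if c (m + Finsupp.single i 1) = i then coeff (m + Finsupp.single i 1) g else 0 := rfl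
  refine ⟨f, ?_, fun i m h => by simp [hf, h]⟩
  ext m
  rw [map_sum]
  rcases eq_or_ne m 0 with rfl | hm
  · simp [hg]
  have hi (i : σ) : coeff m (X i * f i) = if c m = i then coeff m g else 0 := by
    rw [X_def, coeff_monomial_mul, one_mul]
    split_ifs with h₁ h₂ h₂
    · rw [hf, tsub_add_cancel_of_le h₁, if_pos h₂]
    · rw [hf, tsub_add_cancel_of_le h₁, if_neg h₂]
    · subst h₂
      exact absurd (Finsupp.single_le_iff.2 (Nat.one_le_iff_ne_zero.2 (hc m hm))) h₁
    · rfl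
  simp [hi]

theorem exists_even_eq_sum_X_mul_odd [Fintype σ] (h2 : (2 : k) ≠ 0) {g : MvPowerSeries σ k}
    (hg : parityInvolution k σ g = g) (hg0 : constantCoeff g = 0) :
    ∃ f : σ → MvPowerSeries σ k, g = ∑ i, X i * f i ∧
      ∀ i, parityInvolution k σ (f i) = -f i := by
  obtain ⟨f, hf, h⟩ := exists_eq_sum_X_mul hg0
  refine ⟨f, hf, fun i => (parityInvolution_eq_neg_iff h2).2 fun m hm => h i m ?_⟩
  exact (parityInvolution_eq_self_iff h2).1 hg _ (by simpa using hm.add_one)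

theorem constantCoeff_eq_zero_of_odd (h2 : (2 : k) ≠ 0) {g : MvPowerSeries σ k}
    (hg : parityInvolution k σ g = -g) : constantCoeff g = 0 :=
  (parityInvolution_eq_neg_iff h2).1 hg 0 (by simp)

theorem exists_odd_eq_sum_X_mul_even [Fintype σ] (h2 : (2 : k) ≠ 0) {g : MvPowerSeries σ k}
    (hg : parityInvolution k σ g = -g) :
    ∃ f : σ → MvPowerSeries σ k, g = ∑ i, X i * f i ∧
      ∀ i, parityInvolution k σ (f i) = f i := by
  obtain ⟨f, hf, h⟩ := exists_eq_sum_X_mul (constantCoeff_eq_zero_of_odd h2 hg)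
  refine ⟨f, hf, fun i => (parityInvolution_eq_self_iff h2).2 fun m hm => h i m ?_⟩
  exact (parityInvolution_eq_neg_iff h2).1 hg _ (by simpa using hm.add_one)

theorem isLeftRegular_X (i : σ) : IsLeftRegular (X i : MvPowerSeries σ k) := by
  intro f g h
  ext m
  have := congrArg (coeff (Finsupp.single i 1 + m)) h
  simpa [X_def, coeff_add_monomial_mul] using this

theorem X_dvd_of_X_dvd_X_mul {i j : σ} (hij : i ≠ j) {g : MvPowerSeries σ k}
    (h : X i ∣ X j * g) : X i ∣ g := by
  rw [X_dvd_iff] at h ⊢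
  intro m hm
  have := h (Finsupp.single j 1 + m) (by simp [hm, hij.symm])
  rwa [X_def, coeff_add_monomial_mul, one_mul] at this

/-- A monomial of even degree is a product of quadratic monomials. -/
theorem exists_sum_smul_eq_of_even_degree {τ : Type*} (w : τ → σ →₀ ℕ)
    (hw : ∀ i j, ∃ t, w t = Finsupp.single i 1 + Finsupp.single j 1) (n : ℕ) :
    ∀ m : σ →₀ ℕ, m.degree = 2 * n → ∃ d : τ →₀ ℕ, (d.sum fun t e => e • w t) = m := by
  classical
  induction n with
  | zero =>
    intro m hm
    exact ⟨0, by simp [(Finsupp.degree_eq_zero_iff m).1 hm]⟩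
  | succ n ih =>
    have split (m : σ →₀ ℕ) (hm : m.degree ≠ 0) :
        ∃ (i : σ) (m' : σ →₀ ℕ), m = Finsupp.single i 1 + m' := by
      obtain ⟨i, hi⟩ : ∃ i, m i ≠ 0 := by
        simpa [Finsupp.degree_eq_zero_iff, Finsupp.ext_iff] using hm
      exact ⟨i, m - Finsupp.single i 1, (add_tsub_cancel_of_le
        (Finsupp.single_le_iff.2 (Nat.one_le_iff_ne_zero.2 hi))).symm⟩
    intro m hm
    obtain ⟨i, m, rfl⟩ := split m (by lia)
    rw [map_add, Finsupp.degree_single] at hm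
    obtain ⟨j, m, rfl⟩ := split m (by lia)
    rw [map_add, Finsupp.degree_single] at hm
    obtain ⟨d, rfl⟩ := ih m (by lia)
    obtain ⟨t, ht⟩ := hw i j
    refine ⟨Finsupp.single t 1 + d, ?_⟩
    rw [Finsupp.sum_add_index' (by simp) (fun _ _ _ => add_smul _ _ _)]
    simp [ht, add_assoc]

/-- The power series in all the quadratic monomials are exactly the even power series. -/
theorem mem_powerSeriesSubalgebra_iff {τ : Type*} [Finite τ] (h2 : (2 : k) ≠ 0)
    (f : τ → MvPowerSeries σ k) (hf : ∀ t, constantCoeff (f t) = 0)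
    (hquad : ∀ t, ∃ i j, f t = X i * X j) (hall : ∀ i j, ∃ t, f t = X i * X j)
    (g : MvPowerSeries σ k) :
    g ∈ powerSeriesSubalgebra f hf ↔ parityInvolution k σ g = g := by
  classical
  have hs := hasSubst_of_constantCoeff_zero hf
  choose p q hpq using hquad
  let w : τ → σ →₀ ℕ := fun t => Finsupp.single (p t) 1 + Finsupp.single (q t) 1
  have hfw (t : τ) : f t = monomial (w t) 1 := by
    rw [hpq, X_def, X_def, monomial_mul_monomial, one_mul]
  let π : (τ →₀ ℕ) → σ →₀ ℕ := fun d => d.sum fun t e => e • w t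
  have hπ (d : τ →₀ ℕ) : (d.prod fun t e => f t ^ e) = monomial (π d) (1 : k) := by
    simp [π, Finsupp.prod, Finsupp.sum, hfw, monomial_pow, prod_monomial]
  have hcoeff (F : MvPowerSeries τ k) (n : σ →₀ ℕ) :
      coeff n (subst f F) = finsum fun d => coeff d F * if n = π d then 1 else 0 := by
    simp_rw [coeff_subst hs, hπ, coeff_monomial, smul_eq_mul]
  constructor
  · rintro ⟨F, rfl⟩
    rw [parityInvolution_eq_self_iff h2]
    intro n hn
    change coeff n (substAlgHom hs F) = 0
    rw [substAlgHom_apply, hcoeff]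
    refine finsum_eq_zero_of_forall_eq_zero fun d => ?_
    rw [if_neg, mul_zero]
    rintro rfl
    refine Nat.not_even_iff_odd.2 hn ?_
    simp only [π, Finsupp.sum, map_sum, map_nsmul, w, map_add, Finsupp.degree_single]
    exact Finset.even_sum _ fun t _ => ⟨d t, by simp; ring⟩
  · intro hg
    rw [parityInvolution_eq_self_iff h2] at hg
    -- a preimage of `g` supported on one chosen factorization of each monomial of even degree
    have hD : ∀ m : σ →₀ ℕ, Even m.degree → ∃ d, π d = m := by
      rintro m ⟨n, hn⟩
      refine exists_sum_smul_eq_of_even_degree w (fun i j => ?_) n m (by lia)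
      obtain ⟨t, ht⟩ := hall i j
      refine ⟨t, ?_⟩
      rw [hfw, X_def, X_def, monomial_mul_monomial, one_mul] at ht
      by_contra h
      have := congrArg (coeff (w t)) ht
      simp [coeff_monomial, h] at this
    choose! D hD using hD
    let F : MvPowerSeries τ k := fun d => if d = D (π d) then coeff (π d) g else 0
    have hF (d) : coeff d F = if d = D (π d) then coeff (π d) g else 0 := rfl
    refine ⟨F, ?_⟩
    change substAlgHom hs F = g
    rw [substAlgHom_apply]
    ext n
    rw [hcoeff, finsum_eq_single _ (D n)]
    · rcases Nat.even_or_odd n.degree with h | h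
      · simp [hF, hD n h]
      · rw [hg n h]
        split_ifs with h'
        · simp [hF, ← h', hg n h]
        · simp
    · intro d hd
      split_ifs with h'
      · subst h'
        simp [hF, hd]
      · simp

end ParityOfPowerSeries

/-! ### The Veronese subring and its ideal of multiples of a variable -/

section VeroneseSubring

open MvPowerSeries

variable {k : Type*} [Field k] {n : ℕ}

/-- The ideal of the even power series that is generated by the products of `X i` with all the
variables consists of the products of `X i` with the odd power series. -/
theorem mem_span_X_mul_iff (h2 : (2 : k) ≠ 0) {R : Subalgebra k (MvPowerSeries (Fin n) k)}
    (hR : ∀ f, f ∈ R ↔ parityInvolution k (Fin n) f = f) (i : Fin n) (e : Fin n → R)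
    (he : ∀ j, (e j : MvPowerSeries (Fin n) k) = X i * X j) (r : R) :
    r ∈ Ideal.span (Set.range e) ↔
      ∃ m, parityInvolution k (Fin n) m = -m ∧ (r : MvPowerSeries (Fin n) k) = X i * m := by
  rw [Ideal.mem_span_range_iff_exists_fun]
  constructor
  · rintro ⟨c, rfl⟩
    refine ⟨∑ j, (c j : MvPowerSeries (Fin n) k) * X j, ?_, ?_⟩
    · simp [parityInvolution_X, (hR _).1 (c _).2]
    · simp [he, Finset.mul_sum, mul_left_comm]
  · rintro ⟨m, hm, hr⟩
    obtain ⟨f, rfl, hf⟩ := exists_odd_eq_sum_X_mul_even h2 hm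
    refine ⟨fun j => ⟨f j, (hR _).2 (hf j)⟩, Subtype.ext ?_⟩
    rw [hr]
    simp [he, Finset.mul_sum, mul_left_comm, mul_comm]

theorem nonempty_abelianization_aut_prod_ideal (h2 : (2 : k) ≠ 0)
    {R : Subalgebra k (MvPowerSeries (Fin n) k)}
    (hR : ∀ f, f ∈ R ↔ parityInvolution k (Fin n) f = f) {i j : Fin n} (hij : i ≠ j)
    (e : Fin n → R) (he : ∀ j, (e j : MvPowerSeries (Fin n) k) = X i * X j) {I : Ideal R}
    (hI : I = Ideal.span (Set.range e)) :
    Nonempty (Abelianization ((R × I) ≃ₗ[R] (R × I)) ≃* kˣ × Rˣ) := by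
  subst hI
  let χ : MvPowerSeries (Fin n) k →ₐ[k] k :=
    { (constantCoeff : MvPowerSeries (Fin n) k →+* k) with
      commutes' := fun c => by simp [MvPowerSeries.algebraMap_apply] }
  obtain ⟨e₁⟩ := nonempty_aut_mulEquiv_units_gradedMatrices hR (parityInvolution_X i)
    (parityInvolution_X j) (isLeftRegular_X i) (fun _ => X_dvd_of_X_dvd_X_mul hij) _
    (mem_span_X_mul_iff h2 hR i e he)
  obtain ⟨e₂⟩ := nonempty_abelianization_units_gradedMatrices χ R h2
    (fun f hf => isUnit_iff_constantCoeff.2 (isUnit_iff_ne_zero.2 hf))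
    (fun f hf => constantCoeff_eq_zero_of_odd h2 hf)
    (fun a ha ha0 => by
      obtain ⟨f, hf, h⟩ := exists_even_eq_sum_X_mul_odd h2 ha ha0
      exact ⟨n, X, f, parityInvolution_X, h, hf⟩) hR
  exact ⟨e₁.abelianizationCongr.trans e₂⟩

theorem mem_RingTwo_iff (h2 : (2 : k) ≠ 0) (f : MvPowerSeries (Fin 2) k) :
    f ∈ RingTwo k ↔ parityInvolution k (Fin 2) f = f := by
  refine mem_powerSeriesSubalgebra_iff h2 _ _ (fun t => ?_) (fun i j => ?_) f
  · fin_cases t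
    exacts [⟨0, 0, sq _⟩, ⟨0, 1, rfl⟩, ⟨1, 1, sq _⟩]
  · fin_cases i <;> fin_cases j
    exacts [⟨0, sq _⟩, ⟨1, rfl⟩, ⟨1, mul_comm _ _⟩, ⟨2, sq _⟩]

theorem mem_RingThree_iff (h2 : (2 : k) ≠ 0) (f : MvPowerSeries (Fin 3) k) :
    f ∈ RingThree k ↔ parityInvolution k (Fin 3) f = f := by
  refine mem_powerSeriesSubalgebra_iff h2 _ _ (fun t => ?_) (fun i j => ?_) f
  · fin_cases t
    exacts [⟨0, 0, sq _⟩, ⟨0, 1, rfl⟩, ⟨0, 2, rfl⟩, ⟨1, 1, sq _⟩, ⟨1, 2, rfl⟩, ⟨2, 2, sq _⟩]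
  · fin_cases i <;> fin_cases j
    exacts [⟨0, sq _⟩, ⟨1, rfl⟩, ⟨2, rfl⟩, ⟨1, mul_comm _ _⟩, ⟨3, sq _⟩, ⟨4, rfl⟩,
      ⟨2, mul_comm _ _⟩, ⟨4, mul_comm _ _⟩, ⟨5, sq _⟩]

end VeroneseSubring

theorem proposition5p5 {k : Type*} [Field k] :
    (ringChar k ≠ 2 →
      Nonempty (Abelianization ((RingTwo k × idealTwo k) ≃ₗ[RingTwo k] (RingTwo k × idealTwo k))
        ≃* kˣ × (RingTwo k)ˣ)) ∧
    (ringChar k ≠ 2 → ringChar k ≠ 3 →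
      Nonempty (Abelianization
          ((RingThree k × idealThree k) ≃ₗ[RingThree k] (RingThree k × idealThree k))
        ≃* kˣ × (RingThree k)ˣ)) := by
  refine ⟨fun h => ?_, fun h _ => ?_⟩
  · have h2 : (2 : k) ≠ 0 := Ring.two_ne_zero h
    refine nonempty_abelianization_aut_prod_ideal h2 (mem_RingTwo_iff h2) (i := 0) (j := 1)
      (by decide)
      ![⟨MvPowerSeries.X 0 ^ 2, mem_powerSeriesSubalgebra _ (constantCoeff_gensTwo k) 0⟩,
        ⟨MvPowerSeries.X 0 * MvPowerSeries.X 1,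
          mem_powerSeriesSubalgebra _ (constantCoeff_gensTwo k) 1⟩] ?_ ?_
    · intro j
      fin_cases j
      exacts [sq _, rfl]
    · rw [idealTwo]
      congr 1
      ext u
      simp
      tauto
  · have h2 : (2 : k) ≠ 0 := Ring.two_ne_zero h
    refine nonempty_abelianization_aut_prod_ideal h2 (mem_RingThree_iff h2) (i := 0) (j := 1)
      (by decide)
      ![⟨MvPowerSeries.X 0 ^ 2, mem_powerSeriesSubalgebra _ (constantCoeff_gensThree k) 0⟩,
        ⟨MvPowerSeries.X 0 * MvPowerSeries.X 1,
          mem_powerSeriesSubalgebra _ (constantCoeff_gensThree k) 1⟩,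
        ⟨MvPowerSeries.X 0 * MvPowerSeries.X 2,
          mem_powerSeriesSubalgebra _ (constantCoeff_gensThree k) 2⟩] ?_ ?_
    · intro j
      fin_cases j
      exacts [sq _, rfl, rfl]
    · rw [idealThree]
      congr 1
      ext u
      simp
      tauto
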